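/- Let $\Gamma$ and $G$ be countable discrete groups acting measurably and measure-preservingly on a standard Borel probability space $(X,\mu)$. Assume both actions are essentially free (for a.e. $x$ the maps $\gamma\mapsto\gamma x$ and $g\mapsto gx$ are injective) and $\Gamma x\subset Gx$ for a.e. $x$ (so these actions exhibit an orbital embedding of $\Gamma$ in $G$). Let $\mathcal R=\{(s,x)\in X\times X: s\in Gx\}$, with the measure $M$ given by $\int F\,dM=\sum_{g\in G}\int F(gx,x)\,d\mu(x)$. Up to $M$-null sets, $G$ and $\Gamma$ act on $\mathcal R$ by the commuting measure-preserving maps $g(s,x)=(gs,x)$ and $\gamma(s,x)=(s,\gamma x)$. Let $B$ be a complex dual Banach space (with a fixed predual) on which $G$ and $\Gamma$ act by commuting weak-$*$ continuous linear operators; in particular $B$ may be $B(L_2(\mathcal R,M))$ on which $G$ and $\Gamma$ act by conjugation with the unitary representations $(g\cdot F)(\omega)=F(g^{-1}\omega)$ and $(\gamma\cdot F)(\omega)=F(\gamma^{-1}\omega)$. Let $\mathcal L=L_\infty(\mathcal R,M;B)$ be the space of weak-$*$ measurable essentially bounded functions $F:\mathcal R\to B$, modulo a.e. equality, with the essential supremum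 norm and with the commuting actions $(g\cdot F)(\omega)=g\cdot F(g^{-1}\omega)$ and $(\gamma\cdot F)(\omega)=\gamma\cdot F(\gamma^{-1}\omega)$. Let $\mathcal L^G$ and $\mathcal L^\Gamma$ be the subspaces of $G$-invariant and of $\Gamma$-invariant elements; $\mathcal L^G$ is a $\Gamma$-module and $\mathcal L^\Gamma$ is a $G$-module. For a group $K$ acting linearly on a normed space $V$, $H^n_b(K,V)$ is the $n$-th cohomology of the complex of bounded functions $f:K^{n+1}\to V$ with $f(kk_0,\dots,kk_n)=k\cdot f(k_0,\dots,k_n)$ and differential $\partial f(k_0,\dots,k_{n+1})=\sum_{j}(-1)^jf(k_0,\dots,\hat k_j,\dots,k_{n+1})$. Then there is a measurable set $Y\subset X\times X$ such that for $M$-a.e. $\omega$ there is exactly one $\gamma\in\Gamma$ with $\gamma\omega\in Y$ (a fundamental domain for the $\Gamma$-action on $\mathcal R$) and such that $(x,x)\in Y$ for $\mu$-a.e. $x$. For every such $Y$, define $\chi_\omega:G\to\Gamma$, for a.e. $\omega\in\mathcal R$, by $\chi_\omega(g)=\gamma$ if $g\omega\in\gamma Y$. Then for every $n\ge1$ the formula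 $$(\chi^*f)(g_0,\dots,g_n)(\omega)=f\big(\chi_\omega(g_0^{-1}),\dots,\chi_\omega(g_n^{-1})\big)(\omega)$$ sends bounded $\mathcal L^G$-valued $n$-cocycles of $\Gamma$ to bounded $\mathcal L^\Gamma$-valued $n$-cocycles of $G$ and induces an injective linear map $$H^n_b(\Gamma,\mathcal L^G)\longrightarrow H^n_b(G,\mathcal L^\Gamma).$$ -/

import Mathlib

open MeasureTheory Filter

set_option maxSynthPendingDepth 3

noncomputable section

namespace MonodShalom

/-! ### Bounded cohomology of a discrete group -/

section BoundedCohomology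

variable {G V : Type*} [Group G] [NormedAddCommGroup V] [NormedSpace ℂ V]

/-- Homogeneous bounded `n`-cochains: bounded functions `f : G^(n+1) → V` with
`f (g g₀, …, g gₙ) = g · f (g₀, …, gₙ)`. -/
def Cochain (ρ : Representation ℂ G V) (n : ℕ) : Submodule ℂ ((Fin (n + 1) → G) → V) where
  carrier := {f | (∃ C : ℝ, ∀ x, ‖f x‖ ≤ C) ∧ ∀ g x, f (fun i => g * x i) = ρ g (f x)}
  add_mem' := by
    rintro f f' ⟨⟨C, hC⟩, hf⟩ ⟨⟨C', hC'⟩, hf'⟩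
    refine ⟨⟨C + C', fun x => (norm_add_le _ _).trans (add_le_add (hC x) (hC' x))⟩, fun g x => ?_⟩
    simp [hf, hf']
  zero_mem' := ⟨⟨0, fun x => by simp⟩, fun g x => by simp⟩
  smul_mem' := by
    rintro c f ⟨⟨C, hC⟩, hf⟩
    refine ⟨⟨‖c‖ * C, fun x => ?_⟩, fun g x => by simp [hf]⟩
    rw [Pi.smul_apply, norm_smul]
    exact mul_le_mul_of_nonneg_left (hC x) (norm_nonneg c)

/-- `∂f (g₀, …, gₙ₊₁) = ∑ⱼ (-1)ʲ f (g₀, …, ĝⱼ, …, gₙ₊₁)`. -/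
def coboundary (ρ : Representation ℂ G V) (n : ℕ) : Cochain ρ n →ₗ[ℂ] Cochain ρ (n + 1) where
  toFun f := ⟨fun x => ∑ j : Fin (n + 2), (-1 : ℂ) ^ (j : ℕ) • f.1 (fun i => x (j.succAbove i)), by
    obtain ⟨f, ⟨C, hC⟩, hf⟩ := f
    refine ⟨⟨∑ _j : Fin (n + 2), C, fun x => norm_sum_le_of_le _ fun j _ => ?_⟩, fun g x => ?_⟩
    · rw [norm_smul, norm_pow, norm_neg, norm_one, one_pow, one_mul]
      exact hC _
    · simp only [map_sum, map_smul, ← hf]⟩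
  map_add' f f' := by
    ext x
    simp [Finset.sum_add_distrib]
  map_smul' c f := by
    ext x
    simp [Finset.smul_sum, smul_comm c]

/-- Bounded cocycles. -/
def Cocycle (ρ : Representation ℂ G V) (n : ℕ) : Submodule ℂ (Cochain ρ n) :=
  LinearMap.ker (coboundary ρ n)

/-- Bounded coboundaries: the image of the bounded equivariant cochains of one degree less. -/
def Coboundary (ρ : Representation ℂ G V) : (n : ℕ) → Submodule ℂ (Cochain ρ n)
  | 0 => ⊥
  | n + 1 => LinearMap.range (coboundary ρ n)

/-- Bounded cohomology `H_b^n(G, V)`: cocycles modulo coboundaries. -/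
abbrev Hb (ρ : Representation ℂ G V) (n : ℕ) : Type _ :=
  Cocycle ρ n ⧸ (Coboundary ρ n).submoduleOf (Cocycle ρ n)

/-- The class of a bounded cocycle. -/
def Hb.mk (ρ : Representation ℂ G V) (n : ℕ) : Cocycle ρ n →ₗ[ℂ] Hb ρ n :=
  Submodule.mkQ _

end BoundedCohomology

/-- If the representations `ρ` and `σ` commute, the `σ`-invariant vectors form a `ρ`-module. -/
def onInvariants {G K V : Type*} [Group G] [Group K] [AddCommGroup V] [Module ℂ V]
    (ρ : Representation ℂ G V) (σ : Representation ℂ K V)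
    (hc : ∀ g k, Commute (ρ g) (σ k)) : Representation ℂ G σ.invariants :=
  ρ.subrepresentation σ.invariants fun g v hv k => by
    have := LinearMap.congr_fun (hc g k).eq v
    simp only [Module.End.mul_apply] at this
    rw [← this, hv k]

/-! ### Weak-* measurable essentially bounded functions -/

section LInfty

variable {Ω B : Type*} [MeasurableSpace Ω] [NormedAddCommGroup B] [NormedSpace ℂ B]

/-- The canonical map of `B` into the dual of a space `P` of functionals on `B`. -/
def toPredualDual (P : Submodule ℂ (StrongDual ℂ B)) (b : B) : StrongDual ℂ P :=
  (NormedSpace.inclusionInDoubleDual ℂ B b).comp P.subtypeL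

/-- `P ⊆ B*` is a predual of `B`: it is a Banach space (closed in `B*`) and `B` is isometrically
the dual of `P` through the canonical pairing. -/
structure IsPredual (P : Submodule ℂ (StrongDual ℂ B)) : Prop where
  isClosed : IsClosed (P : Set (StrongDual ℂ B))
  isometry : Isometry (toPredualDual P)
  surjective : Function.Surjective (toPredualDual P)

/-- Functions `F : Ω → B` that are weak-* measurable (with respect to the functionals in `P`)
and essentially bounded. -/
def linftyFun (P : Submodule ℂ (StrongDual ℂ B)) (M : Measure Ω) : Submodule ℂ (Ω → B) where
  carrier := {F | (∀ φ ∈ P, AEMeasurable (fun ω => φ (F ω)) M) ∧ eLpNormEssSup F M < ⊤}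
  add_mem' := by
    rintro F F' ⟨h1, h2⟩ ⟨h1', h2'⟩
    refine ⟨fun φ hφ => ?_, eLpNormEssSup_add_le.trans_lt (ENNReal.add_lt_top.2 ⟨h2, h2'⟩)⟩
    simp only [Pi.add_apply, map_add]
    exact (h1 φ hφ).add (h1' φ hφ)
  zero_mem' := ⟨fun φ _ => by simp, by simp⟩
  smul_mem' := by
    rintro c F ⟨h1, h2⟩
    refine ⟨fun φ hφ => by simpa using (h1 φ hφ).const_mul c, ?_⟩
    rw [eLpNormEssSup_const_smul]
    exact ENNReal.mul_lt_top enorm_lt_top h2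

/-- The functions that vanish almost everywhere. -/
def nullFun (P : Submodule ℂ (StrongDual ℂ B)) (M : Measure Ω) : Submodule ℂ (linftyFun P M) where
  carrier := {F | F.1 =ᵐ[M] 0}
  add_mem' := by
    intro F F' (h : F.1 =ᵐ[M] 0) (h' : F'.1 =ᵐ[M] 0)
    change F.1 + F'.1 =ᵐ[M] 0
    simpa using h.add h'
  zero_mem' := by
    change (0 : Ω → B) =ᵐ[M] 0
    rfl
  smul_mem' := by
    intro c F (h : F.1 =ᵐ[M] 0)
    change c • F.1 =ᵐ[M] 0
    simpa using h.const_smul c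

/-- `L_∞(Ω, M; B)`: weak-* measurable essentially bounded functions modulo almost everywhere
equality. -/
def LInfty (P : Submodule ℂ (StrongDual ℂ B)) (M : Measure Ω) : Type _ :=
  linftyFun P M ⧸ nullFun P M

variable {P : Submodule ℂ (StrongDual ℂ B)} {M : Measure Ω}

instance : AddCommGroup (LInfty P M) := inferInstanceAs (AddCommGroup (linftyFun P M ⧸ nullFun P M))

instance : Module ℂ (LInfty P M) := inferInstanceAs (Module ℂ (linftyFun P M ⧸ nullFun P M))

/-- The class of a function. -/
def LInfty.mk : linftyFun P M →ₗ[ℂ] LInfty P M := (nullFun P M).mkQ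

theorem LInfty.mk_surjective : Function.Surjective (LInfty.mk (P := P) (M := M)) :=
  Submodule.Quotient.mk_surjective _

theorem LInfty.mk_eq_mk {F F' : linftyFun P M} :
    LInfty.mk F = LInfty.mk F' ↔ F.1 =ᵐ[M] F'.1 := by
  have h : LInfty.mk F = LInfty.mk F' ↔ F - F' ∈ nullFun P M := Submodule.Quotient.eq _
  rw [h, ← eventuallyEq_iff_sub.symm]
  rfl

/-- A function representing an element of `L_∞(Ω, M; B)`, unique up to a null set. -/
def LInfty.rep (F : LInfty P M) : Ω → B := (LInfty.mk_surjective F).choose.1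

theorem LInfty.rep_mk (F : linftyFun P M) : (LInfty.mk F).rep =ᵐ[M] F.1 :=
  LInfty.mk_eq_mk.1 (LInfty.mk_surjective (LInfty.mk F)).choose_spec

/-- The essential supremum norm. -/
instance : Norm (LInfty P M) := ⟨fun F => (eLpNormEssSup F.rep M).toReal⟩

theorem LInfty.norm_mk (F : linftyFun P M) : ‖LInfty.mk F‖ = (eLpNormEssSup F.1 M).toReal :=
  congrArg ENNReal.toReal (eLpNormEssSup_congr_ae (LInfty.rep_mk F))

theorem LInfty.normCore : NormedSpace.Core ℂ (LInfty P M) where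
  norm_nonneg _ := ENNReal.toReal_nonneg
  norm_smul c F := by
    obtain ⟨F, rfl⟩ := LInfty.mk_surjective F
    rw [← map_smul, LInfty.norm_mk, LInfty.norm_mk, Submodule.coe_smul, eLpNormEssSup_const_smul,
      ENNReal.toReal_mul, toReal_enorm]
  norm_triangle F F' := by
    obtain ⟨F, rfl⟩ := LInfty.mk_surjective F
    obtain ⟨F', rfl⟩ := LInfty.mk_surjective F'
    rw [← map_add, LInfty.norm_mk, LInfty.norm_mk, LInfty.norm_mk, Submodule.coe_add,
      ← ENNReal.toReal_add F.2.2.ne F'.2.2.ne]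
    exact ENNReal.toReal_mono (ENNReal.add_ne_top.2 ⟨F.2.2.ne, F'.2.2.ne⟩) eLpNormEssSup_add_le
  norm_eq_zero_iff F := by
    obtain ⟨F, rfl⟩ := LInfty.mk_surjective F
    rw [LInfty.norm_mk, ENNReal.toReal_eq_zero_iff, or_iff_left F.2.2.ne, eLpNormEssSup_eq_zero_iff,
      ← map_zero LInfty.mk, LInfty.mk_eq_mk]
    rfl

instance : NormedAddCommGroup (LInfty P M) := NormedAddCommGroup.ofCore LInfty.normCore

instance : NormedSpace ℂ (LInfty P M) := NormedSpace.ofCore LInfty.normCore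

/-- The map `F ↦ T ∘ F ∘ τ` on functions, for `T` weak-* continuous and `τ` measure preserving. -/
def transformFun (T : B →L[ℂ] B) (hT : ∀ φ ∈ P, φ.comp T ∈ P) (τ : Ω → Ω)
    (hτ : MeasurePreserving τ M M) : linftyFun P M →ₗ[ℂ] linftyFun P M where
  toFun F := ⟨fun ω => T (F.1 (τ ω)),
    fun φ hφ => (F.2.1 _ (hT φ hφ)).comp_quasiMeasurePreserving hτ.quasiMeasurePreserving, by
      have h1 := hτ.quasiMeasurePreserving.ae (ae_le_eLpNormEssSup (f := F.1) (μ := M))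
      refine (eLpNormEssSup_le_of_ae_enorm_bound (C := ‖T‖ₑ * eLpNormEssSup F.1 M) ?_).trans_lt
        (ENNReal.mul_lt_top enorm_lt_top F.2.2)
      filter_upwards [h1] with ω hω
      exact (T.le_opENorm _).trans (mul_le_mul_right hω _)⟩
  map_add' F F' := by
    ext ω
    simp
  map_smul' c F := by
    ext ω
    simp

/-- The map `F ↦ T ∘ F ∘ τ` on `L_∞(Ω, M; B)`. -/
def transform (T : B →L[ℂ] B) (hT : ∀ φ ∈ P, φ.comp T ∈ P) (τ : Ω → Ω)
    (hτ : MeasurePreserving τ M M) : LInfty P M →ₗ[ℂ] LInfty P M :=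
  (nullFun P M).mapQ (nullFun P M) (transformFun T hT τ hτ) fun F hF => by
    have hF' : F.1 =ᵐ[M] 0 := hF
    have h := hτ.quasiMeasurePreserving.ae hF'
    change _ =ᵐ[M] _
    filter_upwards [h] with ω hω
    simpa [transformFun] using congrArg T hω

theorem transform_mk (T : B →L[ℂ] B) (hT : ∀ φ ∈ P, φ.comp T ∈ P) (τ : Ω → Ω)
    (hτ : MeasurePreserving τ M M) (F : linftyFun P M) :
    transform T hT τ hτ (LInfty.mk F) = LInfty.mk (transformFun T hT τ hτ F) := rfl

end LInfty

/-- A dual Banach space `B` (with predual `predual ⊆ B*`) on which `G` and `Γ` act by commuting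
weak-* continuous linear operators. -/
structure DualBimodule (G Γ B : Type*) [Group G] [Group Γ] [NormedAddCommGroup B]
    [NormedSpace ℂ B] where
  predual : Submodule ℂ (StrongDual ℂ B)
  isPredual : IsPredual predual
  actG : G →* (B →L[ℂ] B)
  actΓ : Γ →* (B →L[ℂ] B)
  commute : ∀ g γ, Commute (actG g) (actΓ γ)
  weakStarG : ∀ g, ∀ φ ∈ predual, φ.comp (actG g) ∈ predual
  weakStarΓ : ∀ γ, ∀ φ ∈ predual, φ.comp (actΓ γ) ∈ predual

/-! ### Orbital embeddings and the orbit equivalence relation -/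

section Orbit

variable {Γ G X : Type*} [Group Γ] [Group G] [MulAction Γ X] [MulAction G X]

/-- The orbit equivalence relation `{(s, x) | s ∈ G x}` of the `G`-action. -/
def orbitRelation (G : Type*) {X : Type*} [Group G] [MulAction G X] : Set (X × X) :=
  {p | p.1 ∈ MulAction.orbit G p.2}

/-- The action of `G` on pairs: `g (s, x) = (g s, x)`. -/
def actLeft (g : G) (p : X × X) : X × X := (g • p.1, p.2)

/-- The action of `Γ` on pairs: `γ (s, x) = (s, γ x)`. -/
def actRight (γ : Γ) (p : X × X) : X × X := (p.1, γ • p.2)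

variable [MeasurableSpace X]

/-- The given actions of `Γ` and `G` on `(X, μ)` are (essentially) free and almost every
`Γ`-orbit is contained in the `G`-orbit of the same point. -/
structure IsOrbitalEmbedding (Γ G : Type*) {X : Type*} [Group Γ] [Group G] [MulAction Γ X]
    [MulAction G X] [MeasurableSpace X] (μ : Measure X) : Prop where
  freeΓ : ∀ᵐ x ∂μ, Function.Injective fun γ : Γ => γ • x
  freeG : ∀ᵐ x ∂μ, Function.Injective fun g : G => g • x
  orbit_subset : ∀ᵐ x ∂μ, MulAction.orbit Γ x ⊆ MulAction.orbit G x

/-- The measure `M` with `∫ F dM = ∑_g ∫ F (g x, x) dμ(x)`. It is a measure on `X × X`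
concentrated on the orbit equivalence relation of `G`, so that functions on the relation modulo
`M`-null sets are the same as functions on `X × X` modulo `M`-null sets. -/
def orbitMeasure (G : Type*) {X : Type*} [Group G] [MulAction G X] [MeasurableSpace X]
    (μ : Measure X) : Measure (X × X) :=
  Measure.sum fun g : G => μ.map fun x => (g • x, x)

variable [Countable G] [MeasurableConstSMul G X] {μ : Measure X}

theorem ae_orbitMeasure_of_forall {p : X × X → Prop} (hp : ∀ᵐ x ∂μ, ∀ g : G, p (g • x, x))
    (hm : MeasurableSet {ω | p ω}) : ∀ᵐ ω ∂orbitMeasure G μ, p ω := by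
  rw [orbitMeasure, Measure.ae_sum_iff]
  intro g
  rw [ae_map_iff (by fun_prop) hm]
  filter_upwards [hp] with x hx using hx g

theorem measurableSet_orbitRelation [StandardBorelSpace X] :
    MeasurableSet (orbitRelation G : Set (X × X)) := by
  have : (orbitRelation G : Set (X × X)) = ⋃ g : G, {p | g • p.2 = p.1} := by
    ext p
    simp [orbitRelation, MulAction.mem_orbit_iff]
  rw [this]
  let := upgradeStandardBorel X
  exact MeasurableSet.iUnion fun g => measurableSet_eq_fun (by fun_prop) (by fun_prop)

theorem orbitMeasure_compl_orbitRelation [StandardBorelSpace X] :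
    orbitMeasure G μ (orbitRelation G)ᶜ = 0 :=
  ae_orbitMeasure_of_forall (p := fun ω => ω ∈ orbitRelation G)
    (Eventually.of_forall fun _ g => ⟨g, rfl⟩) measurableSet_orbitRelation

theorem lintegral_orbitMeasure {F : X × X → ENNReal} (hF : Measurable F) :
    ∫⁻ ω, F ω ∂orbitMeasure G μ = ∫⁻ x, ∑' g : G, F (g • x, x) ∂μ := by
  rw [orbitMeasure, lintegral_sum_measure, lintegral_tsum fun g => by fun_prop]
  exact tsum_congr fun g => lintegral_map hF (by fun_prop)

theorem measurePreserving_actLeft (g : G) :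
    MeasurePreserving (actLeft g) (orbitMeasure G μ) (orbitMeasure G μ) := by
  have hm : Measurable (actLeft g : X × X → X × X) := by unfold actLeft; fun_prop
  refine ⟨hm, Measure.ext_of_lintegral _ fun F hF => ?_⟩
  rw [lintegral_map hF hm, lintegral_orbitMeasure (F := fun ω => F (actLeft g ω)) (hF.comp hm),
    lintegral_orbitMeasure hF]
  refine lintegral_congr fun x => ?_
  simpa [actLeft, mul_smul] using
    (Equiv.mulLeft g).tsum_eq fun k : G => F (k • x, x)

theorem measurePreserving_actRight [MeasurableConstSMul Γ X] [SMulInvariantMeasure Γ X μ]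
    (h : IsOrbitalEmbedding Γ G μ) (γ : Γ) :
    MeasurePreserving (actRight γ) (orbitMeasure G μ) (orbitMeasure G μ) := by
  have hm : Measurable (actRight γ : X × X → X × X) := by unfold actRight; fun_prop
  refine ⟨hm, Measure.ext_of_lintegral _ fun F hF => ?_⟩
  rw [lintegral_map hF hm, lintegral_orbitMeasure (F := fun ω => F (actRight γ ω)) (hF.comp hm),
    lintegral_orbitMeasure hF,
    ← (measurePreserving_smul γ μ).lintegral_comp
      (Measurable.tsum fun g => by fun_prop : Measurable fun x => ∑' g : G, F (g • x, x))]
  refine lintegral_congr_ae ?_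
  filter_upwards [h.orbit_subset] with x hx
  obtain ⟨k, hk⟩ := hx ⟨γ, rfl⟩
  simp only at hk
  simpa [actRight, mul_smul, hk] using
    ((Equiv.mulRight k).tsum_eq fun g : G => F (g • x, γ • x)).symm

end Orbit

/-! ### The module `𝓛 = L_∞(𝓡; B)` -/

section Module

variable {Γ G X : Type*} [Group Γ] [Group G] [Countable G] [MulAction Γ X] [MulAction G X]
  [MeasurableSpace X] [MeasurableConstSMul G X] [MeasurableConstSMul Γ X] {μ : Measure X}
  [SMulInvariantMeasure Γ X μ]
  {B : Type*} [NormedAddCommGroup B] [NormedSpace ℂ B]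

/-- `𝓛 = L_∞(𝓡, M; B)`. -/
abbrev 𝓛 (μ : Measure X) (D : DualBimodule G Γ B) : Type _ :=
  LInfty D.predual (orbitMeasure G μ)

/-- The `G`-action `(g · F)(ω) = g · F (g⁻¹ ω)` on `𝓛`. -/
def repG (μ : Measure X) (D : DualBimodule G Γ B) : Representation ℂ G (𝓛 μ D) where
  toFun g := transform (D.actG g) (D.weakStarG g) (actLeft g⁻¹) (measurePreserving_actLeft g⁻¹)
  map_one' := by
    refine LinearMap.ext fun F => ?_
    obtain ⟨F, rfl⟩ := LInfty.mk_surjective F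
    rw [transform_mk]
    refine congrArg LInfty.mk (Subtype.ext (funext fun ω => ?_))
    simp [transformFun, actLeft]
  map_mul' g g' := by
    refine LinearMap.ext fun F => ?_
    obtain ⟨F, rfl⟩ := LInfty.mk_surjective F
    rw [Module.End.mul_apply, transform_mk, transform_mk, transform_mk]
    refine congrArg LInfty.mk (Subtype.ext (funext fun ω => ?_))
    simp [transformFun, actLeft, mul_smul]

/-- The `Γ`-action `(γ · F)(ω) = γ · F (γ⁻¹ ω)` on `𝓛`. -/
def repΓ (h : IsOrbitalEmbedding Γ G μ) (D : DualBimodule G Γ B) : Representation ℂ Γ (𝓛 μ D) where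
  toFun γ := transform (D.actΓ γ) (D.weakStarΓ γ) (actRight γ⁻¹) (measurePreserving_actRight h γ⁻¹)
  map_one' := by
    refine LinearMap.ext fun F => ?_
    obtain ⟨F, rfl⟩ := LInfty.mk_surjective F
    rw [transform_mk]
    refine congrArg LInfty.mk (Subtype.ext (funext fun ω => ?_))
    simp [transformFun, actRight]
  map_mul' γ γ' := by
    refine LinearMap.ext fun F => ?_
    obtain ⟨F, rfl⟩ := LInfty.mk_surjective F
    rw [Module.End.mul_apply, transform_mk, transform_mk, transform_mk]
    refine congrArg LInfty.mk (Subtype.ext (funext fun ω => ?_))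
    simp [transformFun, actRight, mul_smul]

theorem commute_repG_repΓ (h : IsOrbitalEmbedding Γ G μ) (D : DualBimodule G Γ B) (g : G) (γ : Γ) :
    Commute (repG μ D g) (repΓ h D γ) := by
  refine LinearMap.ext fun F => ?_
  obtain ⟨F, rfl⟩ := LInfty.mk_surjective F
  simp only [Module.End.mul_apply, repG, repΓ, MonoidHom.coe_mk, OneHom.coe_mk, transform_mk]
  refine congrArg LInfty.mk (Subtype.ext (funext fun ω => ?_))
  exact DFunLike.congr_fun (D.commute g γ).eq _

/-- The `Γ`-module `𝓛^G` of `G`-invariant elements. -/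
abbrev invG (h : IsOrbitalEmbedding Γ G μ) (D : DualBimodule G Γ B) :
    Representation ℂ Γ (repG μ D).invariants :=
  onInvariants (repΓ h D) (repG μ D) fun γ g => (commute_repG_repΓ h D g γ).symm

/-- The `G`-module `𝓛^Γ` of `Γ`-invariant elements. -/
abbrev invΓ (h : IsOrbitalEmbedding Γ G μ) (D : DualBimodule G Γ B) :
    Representation ℂ G (repΓ h D).invariants :=
  onInvariants (repG μ D) (repΓ h D) (commute_repG_repΓ h D)

/-- `Y` is a measurable fundamental domain for the `Γ`-action on `(𝓡, M)`, containing the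
diagonal up to a null set: for almost every `ω ∈ 𝓡` exactly one translate `γ ω` is in `Y`. -/
structure IsInductionDomain (Γ G : Type*) {X : Type*} [Group Γ] [Group G] [MulAction Γ X]
    [MulAction G X] [MeasurableSpace X] (μ : Measure X) (Y : Set (X × X)) : Prop where
  measurableSet : MeasurableSet Y
  existsUnique : ∀ᵐ ω ∂orbitMeasure G μ, ∃! γ : Γ, actRight γ ω ∈ Y
  diagonal : ∀ᵐ x ∂μ, (x, x) ∈ Y

open Classical in
/-- `χ_ω(g) = γ` if `g ω ∈ γ Y`. For a fundamental domain `Y` there is exactly one such `γ`, for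
almost every `ω`; on the exceptional null set the value is irrelevant. -/
def chi (Γ : Type*) {G X : Type*} [Group Γ] [Group G] [MulAction Γ X] [MulAction G X]
    (Y : Set (X × X)) (ω : X × X) (g : G) : Γ :=
  if hγ : ∃ γ : Γ, actRight γ⁻¹ (actLeft g ω) ∈ Y then hγ.choose else 1

/-- `f' = χ^* f`, that is, for all `g₀, …, gₙ`, almost everywhere
`f' (g₀, …, gₙ) (ω) = f (χ_ω(g₀⁻¹), …, χ_ω(gₙ⁻¹)) (ω)`. -/
def IsPullback (h : IsOrbitalEmbedding Γ G μ) (D : DualBimodule G Γ B) (Y : Set (X × X)) {n : ℕ}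
    (f : Cocycle (invG h D) n) (f' : Cocycle (invΓ h D) n) : Prop :=
  ∀ g : Fin (n + 1) → G, ∀ᵐ ω ∂orbitMeasure G μ,
    LInfty.rep (f'.1.1 g).1 ω = LInfty.rep (f.1.1 fun i => chi Γ Y ω ((g i)⁻¹)).1 ω

end Module

/-! ### Operators on a Hilbert space, and `B = B(L₂(𝓡))` -/

section Operators

variable {H : Type*} [NormedAddCommGroup H] [InnerProductSpace ℂ H]

/-- The functional `T ↦ ⟨η, T ξ⟩` on `B(H)`. -/
def vectorFunctional (η ξ : H) : StrongDual ℂ (H →L[ℂ] H) :=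
  (innerSL ℂ η).comp (ContinuousLinearMap.apply ℂ H ξ)

/-- The normal functionals on `B(H)`, that is, its standard predual: the closed linear span of the
functionals `T ↦ ⟨η, T ξ⟩`. -/
def normalFunctionals (H : Type*) [NormedAddCommGroup H] [InnerProductSpace ℂ H] :
    Submodule ℂ (StrongDual ℂ (H →L[ℂ] H)) :=
  (Submodule.span ℂ (Set.range fun p : H × H => vectorFunctional p.1 p.2)).topologicalClosure

theorem vectorFunctional_apply (η ξ : H) (T : H →L[ℂ] H) :
    vectorFunctional η ξ T = inner ℂ η (T ξ) := rfl

theorem vectorFunctional_mem (η ξ : H) : vectorFunctional η ξ ∈ normalFunctionals H :=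
  Submodule.le_topologicalClosure _ (Submodule.subset_span ⟨(η, ξ), rfl⟩)

theorem norm_vectorFunctional_le (η ξ : H) : ‖vectorFunctional η ξ‖ ≤ ‖η‖ * ‖ξ‖ := by
  refine ContinuousLinearMap.opNorm_le_bound _ (by positivity) fun T => ?_
  rw [vectorFunctional_apply]
  calc ‖inner ℂ η (T ξ)‖ ≤ ‖η‖ * ‖T ξ‖ := norm_inner_le_norm _ _
    _ ≤ ‖η‖ * (‖T‖ * ‖ξ‖) := by gcongr; exact T.le_opNorm ξ
    _ = ‖η‖ * ‖ξ‖ * ‖T‖ := by ring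

theorem isPredual_normalFunctionals [CompleteSpace H] : IsPredual (normalFunctionals H) := by
  refine ⟨Submodule.isClosed_topologicalClosure _, ?_, ?_⟩
  · let L : (H →L[ℂ] H) →ₗ[ℂ] StrongDual ℂ (normalFunctionals H) :=
      { toFun := toPredualDual (normalFunctionals H)
        map_add' := fun a b => by ext φ; simp [toPredualDual]
        map_smul' := fun c a => by ext φ; simp [toPredualDual] }
    refine AddMonoidHomClass.isometry_of_norm L fun T => le_antisymm ?_ ?_
    · refine ContinuousLinearMap.opNorm_le_bound _ (norm_nonneg _) fun φ => ?_
      exact (φ.1.le_opNorm T).trans_eq (mul_comm _ _)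
    · refine T.opNorm_le_bound (norm_nonneg _) fun ξ => ?_
      have h1 := (L T).le_opNorm ⟨_, vectorFunctional_mem (T ξ) ξ⟩
      have h2 : L T ⟨_, vectorFunctional_mem (T ξ) ξ⟩ = inner ℂ (T ξ) (T ξ) := rfl
      rw [h2, inner_self_eq_norm_sq_to_K, norm_pow, RCLike.norm_ofReal, abs_norm] at h1
      have h3 := h1.trans (mul_le_mul_of_nonneg_left (norm_vectorFunctional_le (T ξ) ξ)
        (norm_nonneg (L T)))
      rcases (norm_nonneg (T ξ)).eq_or_lt with h0 | h0
      · rw [← h0]; positivity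
      · nlinarith
  · intro ψ
    let b : H →L⋆[ℂ] H →L[ℂ] ℂ := LinearMap.mkContinuous₂
      (LinearMap.mk₂'ₛₗ (starRingEnd ℂ) (RingHom.id ℂ)
        (fun η ξ => ψ ⟨_, vectorFunctional_mem η ξ⟩)
        (fun η η' ξ => by
          rw [← map_add]; congr 1; ext T; simp [vectorFunctional_apply])
        (fun c η ξ => by
          rw [← map_smul]; congr 1; ext T
          simp [vectorFunctional_apply, mul_comm])
        (fun η ξ ξ' => by
          rw [← map_add]; congr 1; ext T; simp [vectorFunctional_apply])
        (fun c η ξ => by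
          rw [RingHom.id_apply, ← map_smul]; congr 1; ext T
          simp [vectorFunctional_apply]))
      ‖ψ‖ (fun η ξ => by
        refine (ψ.le_opNorm _).trans ?_
        rw [mul_assoc]
        exact mul_le_mul_of_nonneg_left (norm_vectorFunctional_le η ξ) (norm_nonneg ψ))
    let T : H →L[ℂ] H := (InnerProductSpace.continuousLinearMapOfBilin b).adjoint
    have hT : ∀ η ξ, ψ ⟨_, vectorFunctional_mem η ξ⟩ = inner ℂ η (T ξ) := fun η ξ => by
      rw [ContinuousLinearMap.adjoint_inner_right,
        InnerProductSpace.continuousLinearMapOfBilin_apply]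
      rfl
    refine ⟨T, ?_⟩
    ext ⟨φ, hφ⟩
    let S := Submodule.span ℂ (Set.range fun p : H × H => vectorFunctional p.1 p.2)
    have hspan : ∀ φ (hφ : φ ∈ S),
        toPredualDual (normalFunctionals H) T ⟨φ, Submodule.le_topologicalClosure S hφ⟩ =
          ψ ⟨φ, Submodule.le_topologicalClosure S hφ⟩ := by
      intro φ hφ
      induction hφ using Submodule.span_induction with
      | mem φ h =>
        obtain ⟨p, rfl⟩ := h
        exact (hT p.1 p.2).symm
      | zero => exact (map_zero (toPredualDual (normalFunctionals H) T)).trans (map_zero ψ).symm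
      | add φ φ' h h' ih ih' =>
        have := congrArg₂ (· + ·) ih ih'
        simp only [← map_add] at this
        exact this
      | smul c φ h ih =>
        have := congrArg (c • ·) ih
        simp only [← map_smul] at this
        exact this
    have hd : Dense {φ : normalFunctionals H | φ.1 ∈ S} := by
      rw [Subtype.dense_iff]
      intro φ hφ
      refine closure_mono ?_ hφ
      intro φ' h'
      exact ⟨⟨φ', Submodule.le_topologicalClosure S h'⟩, h', rfl⟩
    have heq : (toPredualDual (normalFunctionals H) T : normalFunctionals H → ℂ) = ψ :=
      Continuous.ext_on hd (ContinuousLinearMap.continuous _) ψ.continuous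
        fun φ hφ => hspan φ.1 hφ
    exact congrFun heq ⟨φ, hφ⟩

/-- Conjugation `T ↦ U(k) T U(k)⁻¹` by a representation on `H`. -/
def conjAct {K : Type*} [Group K] (U : K →* (H →L[ℂ] H)) :
    K →* ((H →L[ℂ] H) →L[ℂ] (H →L[ℂ] H)) where
  toFun k := (ContinuousLinearMap.compL ℂ H H H (U k)).comp
    ((ContinuousLinearMap.compL ℂ H H H).flip (U k⁻¹))
  map_one' := by
    ext T ξ
    simp
  map_mul' k k' := by
    ext T ξ
    simp

theorem conjAct_apply {K : Type*} [Group K] (U : K →* (H →L[ℂ] H)) (k : K) (T : H →L[ℂ] H) :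
    conjAct U k T = U k * T * U k⁻¹ := rfl

theorem commute_conjAct {K K' : Type*} [Group K] [Group K'] (U : K →* (H →L[ℂ] H))
    (U' : K' →* (H →L[ℂ] H)) (hc : ∀ k k', Commute (U k) (U' k')) (k : K) (k' : K') :
    Commute (conjAct U k) (conjAct U' k') := by
  ext1 T
  change U k * (U' k' * T * U' k'⁻¹) * U k⁻¹ = U' k' * (U k * T * U k⁻¹) * U' k'⁻¹
  calc U k * (U' k' * T * U' k'⁻¹) * U k⁻¹
      = (U k * U' k') * T * (U' k'⁻¹ * U k⁻¹) := by simp only [mul_assoc]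
    _ = (U' k' * U k) * T * (U k⁻¹ * U' k'⁻¹) := by rw [(hc k k').eq, (hc k⁻¹ k'⁻¹).eq]
    _ = _ := by simp only [mul_assoc]

theorem comp_conjAct_mem {K : Type*} [Group K] (U : K →* (H →L[ℂ] H))
    (hU : ∀ k ξ, ‖U k ξ‖ = ‖ξ‖) (k : K) :
    ∀ φ ∈ normalFunctionals H, φ.comp (conjAct U k) ∈ normalFunctionals H := by
  have hinner : ∀ η ξ : H, inner ℂ η (U k ξ) = inner ℂ (U k⁻¹ η) ξ := fun η ξ => by
    have h1 : U k (U k⁻¹ η) = η := by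
      rw [← mul_apply_eq_comp, ← map_mul, mul_inv_cancel, map_one]
      rfl
    have h2 := (LinearMap.norm_map_iff_inner_map_map (U k)).1 (hU k) (U k⁻¹ η) ξ
    rwa [h1] at h2
  let R : StrongDual ℂ (H →L[ℂ] H) →L[ℂ] StrongDual ℂ (H →L[ℂ] H) :=
    (ContinuousLinearMap.compL ℂ _ _ ℂ).flip (conjAct U k)
  have hle : Submodule.span ℂ (Set.range fun p : H × H => vectorFunctional p.1 p.2) ≤
      (normalFunctionals H).comap R.toLinearMap := by
    rw [Submodule.span_le]
    rintro _ ⟨p, rfl⟩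
    have : R (vectorFunctional p.1 p.2) = vectorFunctional (U k⁻¹ p.1) (U k⁻¹ p.2) := by
      ext T
      exact hinner _ _
    change R _ ∈ normalFunctionals H
    rw [this]
    exact vectorFunctional_mem _ _
  exact fun φ hφ => Submodule.topologicalClosure_minimal _ hle
    ((Submodule.isClosed_topologicalClosure _).preimage R.continuous) hφ

variable {Γ G X : Type*} [Group Γ] [Group G] [Countable G] [MulAction Γ X] [MulAction G X]
  [MeasurableSpace X] [MeasurableConstSMul G X] [MeasurableConstSMul Γ X] {μ : Measure X}
  [SMulInvariantMeasure Γ X μ]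

/-- The Hilbert space `L₂(𝓡, M)`. -/
abbrev L2R (G : Type*) {X : Type*} [Group G] [MulAction G X] [MeasurableSpace X]
    (μ : Measure X) : Type _ := Lp ℂ 2 (orbitMeasure G μ)

theorem compMeasurePreserving_congr {Ω : Type*} [MeasurableSpace Ω] {M : Measure Ω} {τ τ' : Ω → Ω}
    (e : τ = τ') (hτ : MeasurePreserving τ M M) (hτ' : MeasurePreserving τ' M M) (F : Lp ℂ 2 M) :
    Lp.compMeasurePreserving τ hτ F = Lp.compMeasurePreserving τ' hτ' F := by
  subst e
  rfl

/-- The representation `(g · F)(s, x) = F (g⁻¹ s, x)` of `G` on `L₂(𝓡)`. -/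
def unitaryG (G : Type*) {X : Type*} [Group G] [Countable G] [MulAction G X] [MeasurableSpace X]
    [MeasurableConstSMul G X] (μ : Measure X) : G →* (L2R G μ →L[ℂ] L2R G μ) where
  toFun g := (Lp.compMeasurePreservingₗᵢ ℂ (actLeft g⁻¹)
    (measurePreserving_actLeft g⁻¹)).toContinuousLinearMap
  map_one' := by
    ext1 F
    change Lp.compMeasurePreserving (actLeft (1 : G)⁻¹) _ F = F
    exact (compMeasurePreserving_congr (by ext p <;> simp [actLeft]) _ (.id _) F).trans
      (Lp.compMeasurePreserving_id_apply F)
  map_mul' g g' := by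
    ext1 F
    change Lp.compMeasurePreserving (actLeft (g * g')⁻¹) _ F =
      Lp.compMeasurePreserving (actLeft g⁻¹) _ (Lp.compMeasurePreserving (actLeft g'⁻¹) _ F)
    exact (compMeasurePreserving_congr (by ext p <;> simp [actLeft, mul_smul]) _ _ F).trans
      (Lp.compMeasurePreserving_comp_apply F _ _)

/-- The representation `(γ · F)(s, x) = F (s, γ⁻¹ x)` of `Γ` on `L₂(𝓡)`. -/
def unitaryΓ (h : IsOrbitalEmbedding Γ G μ) : Γ →* (L2R G μ →L[ℂ] L2R G μ) where
  toFun γ := (Lp.compMeasurePreservingₗᵢ ℂ (actRight γ⁻¹)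
    (measurePreserving_actRight h γ⁻¹)).toContinuousLinearMap
  map_one' := by
    ext1 F
    change Lp.compMeasurePreserving (actRight (1 : Γ)⁻¹) _ F = F
    exact (compMeasurePreserving_congr (by ext p <;> simp [actRight]) _ (.id _) F).trans
      (Lp.compMeasurePreserving_id_apply F)
  map_mul' γ γ' := by
    ext1 F
    change Lp.compMeasurePreserving (actRight (γ * γ')⁻¹) _ F =
      Lp.compMeasurePreserving (actRight γ⁻¹) _ (Lp.compMeasurePreserving (actRight γ'⁻¹) _ F)
    exact (compMeasurePreserving_congr (by ext p <;> simp [actRight, mul_smul]) _ _ F).trans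
      (Lp.compMeasurePreserving_comp_apply F _ _)

theorem commute_unitary (h : IsOrbitalEmbedding Γ G μ) (g : G) (γ : Γ) :
    Commute (unitaryG G μ g) (unitaryΓ h γ) := by
  ext1 F
  have hl := measurePreserving_actLeft (μ := μ) g⁻¹
  have hr := measurePreserving_actRight h γ⁻¹
  change Lp.compMeasurePreserving (actLeft g⁻¹) hl (Lp.compMeasurePreserving (actRight γ⁻¹) hr F) =
    Lp.compMeasurePreserving (actRight γ⁻¹) hr (Lp.compMeasurePreserving (actLeft g⁻¹) hl F)
  rw [← Lp.compMeasurePreserving_comp_apply F hr hl, ← Lp.compMeasurePreserving_comp_apply F hl hr]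
  exact compMeasurePreserving_congr rfl _ _ F

theorem norm_unitaryG (g : G) (F : L2R G μ) : ‖unitaryG G μ g F‖ = ‖F‖ :=
  Lp.norm_compMeasurePreserving F (measurePreserving_actLeft g⁻¹)

theorem norm_unitaryΓ (h : IsOrbitalEmbedding Γ G μ) (γ : Γ) (F : L2R G μ) :
    ‖unitaryΓ h γ F‖ = ‖F‖ :=
  Lp.norm_compMeasurePreserving F (measurePreserving_actRight h γ⁻¹)

/-- `B = B(L₂(𝓡))`, with `G` and `Γ` acting by conjugation with their unitary representations on
`L₂(𝓡)`. -/
def operatorBimodule (h : IsOrbitalEmbedding Γ G μ) :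
    DualBimodule G Γ (L2R G μ →L[ℂ] L2R G μ) where
  predual := normalFunctionals (L2R G μ)
  isPredual := isPredual_normalFunctionals
  actG := conjAct (unitaryG G μ)
  actΓ := conjAct (unitaryΓ h)
  commute g γ := commute_conjAct _ _ (commute_unitary h) g γ
  weakStarG := comp_conjAct_mem _ norm_unitaryG
  weakStarΓ := comp_conjAct_mem _ (norm_unitaryΓ h)

end Operators

end MonodShalom

end

noncomputable section

namespace MonodShalom

/-! ### Maps induced on bounded cohomology -/

section Induced

variable {K L V W : Type*} [Group K] [Group L] [NormedAddCommGroup V] [NormedSpace ℂ V]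
  [NormedAddCommGroup W] [NormedSpace ℂ W] {ρ : Representation ℂ K V} {σ : Representation ℂ L W}

/-! The two groups play symmetric roles on `𝓡`: each has a fundamental domain, `Y` for `Γ` and, by
freeness of `G`, the diagonal `Δ` for `G`. A fundamental domain of a group `K` gives an index map `κ
: 𝓡 → K`, sending `ω` to the `k` with `ω ∈ k Y`, and `κ` is equivariant almost everywhere. If `L`
acts by maps commuting with those of `K`, then `(l₀, …, lₙ) ↦ (ω ↦ f (κ (l₀⁻¹ ω), …, κ (lₙ⁻¹ ω))
(ω))` turns `K`-cochains with `L`-invariant values into `L`-cochains with `K`-invariant values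
(`pullback`). This is a chain map which does not increase the supremum norm. Applied to `Y` it is
`χ^*`, because `χ_ω(g) = κ(g ω)`.

Injectivity needs no homotopy: the pullback along the index map `κ'` of `Δ` is a left inverse of
`χ^*` already on cochains. Indeed, if `g = κ'(γ⁻¹ ω)`, then `g⁻¹ γ⁻¹ ω ∈ Δ`. As `Y` contains almost
all of the diagonal, `g⁻¹ ω ∈ γ Y`, that is, `κ(g⁻¹ ω) = γ`. This is `domainIndex_actRight_actLeft`,
and `pullback_pullback` concludes.

Elements of `𝓛` are classes of functions, so each pointwise identity is checked on representatives.
Countability of the groups puts the exceptional sets for all tuples into one null set.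

A suitable `Y` exists by a first-return choice along an enumeration of `G` that starts with `1`. -/

theorem exists_norm_cochain_le {n : ℕ} (f : Cochain ρ n) : ∃ C : ℝ, 0 ≤ C ∧ ∀ x, ‖f.1 x‖ ≤ C := by
  obtain ⟨C, hC⟩ := f.2.1
  exact ⟨C, (norm_nonneg _).trans (hC 1), hC⟩

theorem coboundary_apply {n : ℕ} (f : Cochain ρ n) (x : Fin (n + 2) → K) :
    (coboundary ρ n f).1 x =
      ∑ j : Fin (n + 2), (-1 : ℂ) ^ (j : ℕ) • f.1 (fun i => x (j.succAbove i)) := rfl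

/-- The restriction to cocycles of a linear map of cochains commuting with the differential. -/
def cocycleMap {n : ℕ} (φ : Cochain ρ n →ₗ[ℂ] Cochain σ n)
    (φ' : Cochain ρ (n + 1) →ₗ[ℂ] Cochain σ (n + 1))
    (hφ : ∀ f, φ' (coboundary ρ n f) = coboundary σ n (φ f)) : Cocycle ρ n →ₗ[ℂ] Cocycle σ n :=
  φ.restrict fun f hf => by
    rw [Cocycle, LinearMap.mem_ker] at hf ⊢
    rw [← hφ, hf, map_zero]

/-- The map on bounded cohomology induced by a chain map. -/
def hbMap (φ : ∀ n, Cochain ρ n →ₗ[ℂ] Cochain σ n)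
    (hφ : ∀ n f, φ (n + 1) (coboundary ρ n f) = coboundary σ n (φ n f)) (n : ℕ) :
    Hb ρ n →ₗ[ℂ] Hb σ n :=
  Submodule.mapQ _ _ (cocycleMap (φ n) (φ (n + 1)) (hφ n)) fun f hf => by
    -- Degree zero is separate because the coboundaries there are `⊥` by definition and not a range.
    change f.1 ∈ Coboundary ρ n at hf
    change φ n f.1 ∈ Coboundary σ n
    cases n with
    | zero =>
      have h0 : f.1 = 0 := hf
      rw [h0, map_zero]
      exact zero_mem _
    | succ n =>
      obtain ⟨b, hb⟩ := hf
      have hb' : coboundary ρ n b = f.1 := hb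
      exact ⟨φ n b, by rw [← hφ, hb']⟩

theorem hbMap_mk (φ : ∀ n, Cochain ρ n →ₗ[ℂ] Cochain σ n)
    (hφ : ∀ n f, φ (n + 1) (coboundary ρ n f) = coboundary σ n (φ n f)) (n : ℕ)
    (f : Cocycle ρ n) :
    hbMap φ hφ n (Hb.mk ρ n f) = Hb.mk σ n (cocycleMap (φ n) (φ (n + 1)) (hφ n) f) := rfl

/-- A chain map with a left inverse chain map is injective on bounded cohomology. -/
theorem hbMap_injective (φ : ∀ n, Cochain ρ n →ₗ[ℂ] Cochain σ n)
    (hφ : ∀ n f, φ (n + 1) (coboundary ρ n f) = coboundary σ n (φ n f))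
    (ψ : ∀ n, Cochain σ n →ₗ[ℂ] Cochain ρ n)
    (hψ : ∀ n f, ψ (n + 1) (coboundary σ n f) = coboundary ρ n (ψ n f))
    (hψφ : ∀ n f, ψ n (φ n f) = f) (n : ℕ) : Function.Injective (hbMap φ hφ n) := by
  refine Function.LeftInverse.injective (g := hbMap ψ hψ n) fun c => ?_
  obtain ⟨f, rfl⟩ := Submodule.mkQ_surjective _ c
  change hbMap ψ hψ n (hbMap φ hφ n (Hb.mk ρ n f)) = Hb.mk ρ n f
  rw [hbMap_mk, hbMap_mk]
  exact congrArg _ (Subtype.ext (hψφ n f.1))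

end Induced

/-! ### Representatives of elements of `L_∞(Ω, M; B)` -/

section Representatives

variable {Ω B : Type*} [MeasurableSpace Ω] [NormedAddCommGroup B] [NormedSpace ℂ B]
  {P : Submodule ℂ (StrongDual ℂ B)} {M : Measure Ω}

theorem LInfty.rep_mem (F : LInfty P M) : F.rep ∈ linftyFun P M :=
  (LInfty.mk_surjective F).choose.2

theorem LInfty.mk_rep (F : LInfty P M) : LInfty.mk ⟨F.rep, F.rep_mem⟩ = F :=
  (LInfty.mk_surjective F).choose_spec

theorem LInfty.ext_rep {F F' : LInfty P M} (h : F.rep =ᵐ[M] F'.rep) : F = F' := by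
  rw [← F.mk_rep, ← F'.mk_rep, LInfty.mk_eq_mk]
  exact h

theorem LInfty.rep_add (F F' : LInfty P M) : (F + F').rep =ᵐ[M] F.rep + F'.rep := by
  conv_lhs => rw [← F.mk_rep, ← F'.mk_rep, ← map_add]
  exact LInfty.rep_mk _

theorem LInfty.rep_smul (c : ℂ) (F : LInfty P M) : (c • F).rep =ᵐ[M] c • F.rep := by
  conv_lhs => rw [← F.mk_rep, ← map_smul]
  exact LInfty.rep_mk _

theorem LInfty.rep_zero : (0 : LInfty P M).rep =ᵐ[M] 0 := by
  rw [← map_zero LInfty.mk]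
  exact LInfty.rep_mk _

/-- Representatives are arbitrary choices, so `rep` is additive only off a null set; this serves to
evaluate coboundaries pointwise. -/
theorem LInfty.rep_sum {ι : Type*} (s : Finset ι) (F : ι → LInfty P M) :
    (∑ i ∈ s, F i).rep =ᵐ[M] fun ω => ∑ i ∈ s, (F i).rep ω := by
  classical
  induction s using Finset.induction_on with
  | empty =>
    simp only [Finset.sum_empty]
    exact LInfty.rep_zero
  | insert i s hi ih =>
    rw [Finset.sum_insert hi]
    filter_upwards [LInfty.rep_add (F i) (∑ j ∈ s, F j), ih] with ω h1 h2
    rw [h1, Pi.add_apply, h2, Finset.sum_insert hi]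

theorem LInfty.ae_norm_rep_le (F : LInfty P M) : ∀ᵐ ω ∂M, ‖F.rep ω‖ ≤ ‖F‖ := by
  filter_upwards [ae_le_eLpNormEssSup (f := F.rep) (μ := M)] with ω hω
  rw [← toReal_enorm]
  exact ENNReal.toReal_mono F.rep_mem.2.ne hω

theorem LInfty.norm_le_of_ae {F : LInfty P M} {C : ℝ} (hC : 0 ≤ C)
    (h : ∀ᵐ ω ∂M, ‖F.rep ω‖ ≤ C) : ‖F‖ ≤ C := by
  refine ENNReal.toReal_le_of_le_ofReal hC (eLpNormEssSup_le_of_ae_enorm_bound ?_)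
  filter_upwards [h] with ω hω
  rw [← ofReal_norm]
  exact ENNReal.ofReal_le_ofReal hω

theorem rep_transform (T : B →L[ℂ] B) (hT : ∀ φ ∈ P, φ.comp T ∈ P) (τ : Ω → Ω)
    (hτ : MeasurePreserving τ M M) (F : LInfty P M) :
    (transform T hT τ hτ F).rep =ᵐ[M] fun ω => T (F.rep (τ ω)) := by
  conv_lhs => rw [← F.mk_rep, transform_mk]
  exact LInfty.rep_mk _

/-! ### Gluing countably many elements of `L_∞` -/

open Classical in
/-- The function `ω ↦ f (c ω) (ω)`, for a family `f` of elements of `L_∞(Ω, M; B)`. It is zero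
unless this function is weak-* measurable and essentially bounded. -/
def glue {ι : Type*} (f : ι → LInfty P M) (c : Ω → ι) : LInfty P M :=
  if h : (fun ω => (f (c ω)).rep ω) ∈ linftyFun P M then LInfty.mk ⟨_, h⟩ else 0

/-- The fibres of `c` form a countable partition into null-measurable sets, and on the fibre over
`i` the function is the representative of the single element `f i`. The uniform bound `C` gives
essential boundedness. -/
theorem glue_mem {ι : Type*} [Countable ι] {f : ι → LInfty P M} {C : ℝ} (hf : ∀ i, ‖f i‖ ≤ C)
    {c : Ω → ι} (hc : ∀ i, NullMeasurableSet (c ⁻¹' {i}) M) :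
    (fun ω => (f (c ω)).rep ω) ∈ linftyFun P M := by
  constructor
  · intro φ hφ
    have hU : (⋃ i, c ⁻¹' {i}) = Set.univ := by ext; simp
    suffices h : AEMeasurable (fun ω => φ ((f (c ω)).rep ω)) (M.restrict (⋃ i, c ⁻¹' {i})) by
      rwa [hU, Measure.restrict_univ] at h
    rw [aemeasurable_iUnion_iff]
    intro i
    refine (((f i).rep_mem.1 φ hφ).mono_measure Measure.restrict_le_self).congr ?_
    filter_upwards [ae_restrict_mem₀ (hc i)] with ω hω
    rw [Set.mem_preimage, Set.mem_singleton_iff] at hω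
    rw [hω]
  · refine (eLpNormEssSup_le_of_ae_enorm_bound (C := ENNReal.ofReal C) ?_).trans_lt
      ENNReal.ofReal_lt_top
    filter_upwards [ae_all_iff.2 fun i => (f i).ae_norm_rep_le] with ω hω
    rw [← ofReal_norm]
    exact ENNReal.ofReal_le_ofReal ((hω _).trans (hf _))

theorem rep_glue {ι : Type*} [Countable ι] {f : ι → LInfty P M} {C : ℝ} (hf : ∀ i, ‖f i‖ ≤ C)
    {c : Ω → ι} (hc : ∀ i, NullMeasurableSet (c ⁻¹' {i}) M) :
    (glue f c).rep =ᵐ[M] fun ω => (f (c ω)).rep ω := by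
  rw [glue, dif_pos (glue_mem hf hc)]
  exact LInfty.rep_mk _

theorem norm_glue_le {ι : Type*} [Countable ι] {f : ι → LInfty P M} {C : ℝ} (hC : 0 ≤ C)
    (hf : ∀ i, ‖f i‖ ≤ C) {c : Ω → ι} (hc : ∀ i, NullMeasurableSet (c ⁻¹' {i}) M) :
    ‖glue f c‖ ≤ C := by
  refine LInfty.norm_le_of_ae hC ?_
  filter_upwards [rep_glue hf hc, ae_all_iff.2 fun i => (f i).ae_norm_rep_le] with ω h1 h2
  rw [h1]
  exact (h2 _).trans (hf _)

end Representatives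

/-! ### Essential fundamental domains and their index maps -/

section Domain

variable {Ω K : Type*} [Group K] {t : K → Ω → Ω} {Y : Set Ω}

/-- `t` is an action of `K` on `Ω` by maps preserving the null sets of `M`. -/
structure IsNonsingularAction [MeasurableSpace Ω] (M : Measure Ω) (t : K → Ω → Ω) : Prop where
  one : ∀ ω, t 1 ω = ω
  mul : ∀ k l ω, t (k * l) ω = t k (t l ω)
  quasi : ∀ k, Measure.QuasiMeasurePreserving (t k) M M

open Classical in
/-- The element `k` with `ω ∈ k Y`, for a fundamental domain `Y`. -/
def domainIndex (t : K → Ω → Ω) (Y : Set Ω) (ω : Ω) : K :=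
  if hk : ∃ k : K, t k⁻¹ ω ∈ Y then hk.choose else 1

/-- Uniqueness makes the arbitrary choice in `domainIndex` harmless. The hypothesis counts the `k`
with `k ω ∈ Y`, whereas the index is the `k` with `ω ∈ k Y`, hence the inverses. -/
theorem domainIndex_eq_iff {ω : Ω} (h : ∃! k, t k ω ∈ Y) (k : K) :
    domainIndex t Y ω = k ↔ t k⁻¹ ω ∈ Y := by
  obtain ⟨k₀, h₀, hu⟩ := h
  have hex : ∃ k : K, t k⁻¹ ω ∈ Y := ⟨k₀⁻¹, by simpa using h₀⟩
  rw [domainIndex, dif_pos hex]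
  constructor
  · rintro rfl
    exact hex.choose_spec
  · intro hk
    exact inv_injective ((hu _ hex.choose_spec).trans (hu _ hk).symm)

variable [MeasurableSpace Ω] {M : Measure Ω}

/-- Off a null set the fibre over `k` is the translate `k Y`, the preimage of `Y` under `k⁻¹`. On
that null set the index is arbitrary, so only null-measurability can be expected. -/
theorem nullMeasurableSet_domainIndex (ht : IsNonsingularAction M t) (hY : MeasurableSet Y)
    (h : ∀ᵐ ω ∂M, ∃! k, t k ω ∈ Y) (k : K) :
    NullMeasurableSet (domainIndex t Y ⁻¹' {k}) M := by
  refine ((ht.quasi k⁻¹).measurable hY).nullMeasurableSet.congr ?_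
  filter_upwards [h] with ω hω
  exact propext (domainIndex_eq_iff hω k).symm

/-- `k ω ∈ m Y` exactly when `ω ∈ k⁻¹ m Y`. Uniqueness is needed at both `ω` and `k ω`, and
nonsingularity of the action transports it. -/
theorem domainIndex_smul (ht : IsNonsingularAction M t) (h : ∀ᵐ ω ∂M, ∃! k, t k ω ∈ Y) (k : K) :
    ∀ᵐ ω ∂M, domainIndex t Y (t k ω) = k * domainIndex t Y ω := by
  filter_upwards [h, (ht.quasi k).ae h] with ω h1 h2
  rw [domainIndex_eq_iff h2, ← ht.mul, mul_inv_rev, inv_mul_cancel_right,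
    ← domainIndex_eq_iff h1]

theorem nullMeasurableSet_indexTuple {Ω K L : Type*} [MeasurableSpace Ω] [Group L]
    {M : Measure Ω} {t' : L → Ω → Ω} (ht' : IsNonsingularAction M t') {κ : Ω → K}
    (hκ : ∀ k, NullMeasurableSet (κ ⁻¹' {k}) M) {n : ℕ} (a : Fin n → L) (b : Fin n → K) :
    NullMeasurableSet ((fun ω i => κ (t' (a i)⁻¹ ω)) ⁻¹' {b}) M := by
  have : (fun ω i => κ (t' (a i)⁻¹ ω)) ⁻¹' {b} = ⋂ i, t' (a i)⁻¹ ⁻¹' (κ ⁻¹' {b i}) := by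
    ext ω
    simp [funext_iff]
  rw [this]
  exact NullMeasurableSet.iInter fun i => (hκ (b i)).preimage (ht'.quasi _)

end Domain

/-! ### The pullback of cochains along an equivariant index map -/

section Pullback

variable {Ω B K L : Type*} [MeasurableSpace Ω] [NormedAddCommGroup B] [NormedSpace ℂ B]
  [Group K] [Group L] {P : Submodule ℂ (StrongDual ℂ B)} {M : Measure Ω}

/-- `ρ` is the representation `(k · F)(ω) = k · F (k⁻¹ ω)` for the actions `t` on `Ω` and `A`
on `B`. -/
structure IsInducedRep (ρ : Representation ℂ K (LInfty P M)) (A : K → B → B)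
    (t : K → Ω → Ω) : Prop extends IsNonsingularAction M t where
  rep_apply : ∀ k F, (ρ k F).rep =ᵐ[M] fun ω => A k (F.rep (t k⁻¹ ω))

variable {ρ : Representation ℂ K (LInfty P M)} {A : K → B → B} {t : K → Ω → Ω}
  {σ : Representation ℂ L (LInfty P M)} {A' : L → B → B} {t' : L → Ω → Ω}

/-- An index map `κ : Ω → K` for the action `t`, with null-measurable fibres. -/
structure IsIndexMap (M : Measure Ω) (t : K → Ω → Ω) (κ : Ω → K) : Prop where
  nullMeasurableSet : ∀ k, NullMeasurableSet (κ ⁻¹' {k}) M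
  smul : ∀ k, ∀ᵐ ω ∂M, κ (t k ω) = k * κ ω

theorem isIndexMap_domainIndex {Y : Set Ω} (ht : IsNonsingularAction M t) (hY : MeasurableSet Y)
    (h : ∀ᵐ ω ∂M, ∃! k, t k ω ∈ Y) : IsIndexMap M t (domainIndex t Y) :=
  ⟨nullMeasurableSet_domainIndex ht hY h, domainIndex_smul ht h⟩

theorem rep_coboundary {hc : ∀ k l, Commute (ρ k) (σ l)} {n : ℕ}
    (f : Cochain (onInvariants ρ σ hc) n) (a : Fin (n + 2) → K) :
    ((coboundary _ n f).1 a).1.rep =ᵐ[M]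
      fun ω => ∑ j : Fin (n + 2), (-1 : ℂ) ^ (j : ℕ) • (f.1 fun i => a (j.succAbove i)).1.rep ω := by
  have h : ((coboundary _ n f).1 a).1 =
      ∑ j : Fin (n + 2), (-1 : ℂ) ^ (j : ℕ) • (f.1 fun i => a (j.succAbove i)).1 := by
    rw [coboundary_apply, Submodule.coe_sum]
    rfl
  rw [h]
  filter_upwards [LInfty.rep_sum Finset.univ fun j : Fin (n + 2) =>
    (-1 : ℂ) ^ (j : ℕ) • (f.1 fun i => a (j.succAbove i)).1,
    ae_all_iff.2 fun j : Fin (n + 2) => LInfty.rep_smul ((-1 : ℂ) ^ (j : ℕ))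
      (f.1 fun i => a (j.succAbove i)).1] with ω h1 h2
  rw [h1]
  exact Finset.sum_congr rfl fun j _ => h2 j

variable [Countable K] {κ : Ω → K}

theorem rep_glue_indexTuple {hc : ∀ k l, Commute (ρ k) (σ l)}
    (ht' : IsNonsingularAction M t') (hκ : IsIndexMap M t κ) {n : ℕ}
    (f : Cochain (onInvariants ρ σ hc) n) (a : Fin (n + 1) → L) :
    (glue (fun b => (f.1 b).1) fun ω i => κ (t' (a i)⁻¹ ω)).rep =ᵐ[M]
      fun ω => (f.1 fun i => κ (t' (a i)⁻¹ ω)).1.rep ω := by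
  obtain ⟨C, -, hC⟩ := exists_norm_cochain_le f
  exact rep_glue (f := fun b => (f.1 b).1) hC
    (nullMeasurableSet_indexTuple ht' hκ.nullMeasurableSet a)

/-- Applying `k` evaluates at `k⁻¹ ω`, which multiplies every index by `k⁻¹` because the two actions
on `Ω` commute. Equivariance of `f` under `k` cancels this factor. -/
theorem glue_indexTuple_mem_invariants {hc : ∀ k l, Commute (ρ k) (σ l)}
    (hρ : IsInducedRep ρ A t) (hσ : IsInducedRep σ A' t')
    (htt' : ∀ k l ω, t k (t' l ω) = t' l (t k ω)) (hκ : IsIndexMap M t κ) {n : ℕ}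
    (f : Cochain (onInvariants ρ σ hc) n) (a : Fin (n + 1) → L) :
    glue (fun b => (f.1 b).1) (fun ω i => κ (t' (a i)⁻¹ ω)) ∈ ρ.invariants := by
  intro k
  refine LInfty.ext_rep ?_
  have hg := rep_glue_indexTuple hσ.toIsNonsingularAction hκ f a
  have hf : ∀ᵐ ω ∂M, ∀ b : Fin (n + 1) → K, (f.1 fun i => k * b i).1.rep ω =
      A k ((f.1 b).1.rep (t k⁻¹ ω)) := ae_all_iff.2 fun b => by
    have : (f.1 fun i => k * b i).1 = ρ k (f.1 b).1 := congrArg Subtype.val (f.2.2 k b)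
    rw [this]
    exact hρ.rep_apply k _
  have hk : ∀ᵐ ω ∂M, ∀ i, κ (t k⁻¹ (t' (a i)⁻¹ ω)) = k⁻¹ * κ (t' (a i)⁻¹ ω) :=
    ae_all_iff.2 fun i => (hσ.quasi _).ae (hκ.smul k⁻¹)
  filter_upwards [hρ.rep_apply k (glue (fun b => (f.1 b).1) fun ω i => κ (t' (a i)⁻¹ ω)), hg,
    (hρ.quasi k⁻¹).ae hg, hf, hk] with ω h1 h2 h3 h4 h5
  -- The equivariance `h4` holds for all tuples `b` at once, so it applies to the tuple of indices,
  -- which depends on `ω`.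
  rw [h1, h3, h2, ← h4]
  simp only [← htt', h5, mul_inv_cancel_left]

/-- Translating the arguments by `l` amounts to evaluating the indices at `l⁻¹ ω`. The remaining
change, from `f (b) (ω)` to `l · f (b) (l⁻¹ ω)`, is the `L`-invariance of the values of `f`. -/
theorem glue_indexTuple_smul {hc : ∀ k l, Commute (ρ k) (σ l)}
    (hσ : IsInducedRep σ A' t') (hκ : IsIndexMap M t κ) {n : ℕ}
    (f : Cochain (onInvariants ρ σ hc) n) (l : L) (a : Fin (n + 1) → L) :
    glue (fun b => (f.1 b).1) (fun ω i => κ (t' (l * a i)⁻¹ ω)) =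
      σ l (glue (fun b => (f.1 b).1) (fun ω i => κ (t' (a i)⁻¹ ω))) := by
  refine LInfty.ext_rep ?_
  have hf : ∀ᵐ ω ∂M, ∀ b : Fin (n + 1) → K, (f.1 b).1.rep ω =
      A' l ((f.1 b).1.rep (t' l⁻¹ ω)) := ae_all_iff.2 fun b => by
    have := hσ.rep_apply l (f.1 b).1
    rwa [(f.1 b).2 l] at this
  filter_upwards [hσ.rep_apply l (glue (fun b => (f.1 b).1) fun ω i => κ (t' (a i)⁻¹ ω)),
    rep_glue_indexTuple hσ.toIsNonsingularAction hκ f fun i => l * a i,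
    (hσ.quasi l⁻¹).ae (rep_glue_indexTuple hσ.toIsNonsingularAction hκ f a), hf] with ω h1 h2 h3 h4
  rw [h1, h2, h3, h4]
  simp only [mul_inv_rev, hσ.mul]

/-- The pullback `(l₀, …, lₙ) ↦ (ω ↦ f (κ (l₀⁻¹ ω), …, κ (lₙ⁻¹ ω)) (ω))` of cochains along an
index map `κ`. -/
def pullback {hc : ∀ k l, Commute (ρ k) (σ l)}
    (hρ : IsInducedRep ρ A t) (hσ : IsInducedRep σ A' t')
    (htt' : ∀ k l ω, t k (t' l ω) = t' l (t k ω)) (hκ : IsIndexMap M t κ) (n : ℕ) :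
    Cochain (onInvariants ρ σ hc) n →ₗ[ℂ]
      Cochain (onInvariants σ ρ fun l k => (hc k l).symm) n where
  toFun f := ⟨fun a => ⟨glue (fun b => (f.1 b).1) (fun ω i => κ (t' (a i)⁻¹ ω)),
      glue_indexTuple_mem_invariants hρ hσ htt' hκ f a⟩, by
    obtain ⟨C, hC0, hC⟩ := exists_norm_cochain_le f
    exact ⟨⟨C, fun a => norm_glue_le (f := fun b => (f.1 b).1) hC0 hC
      (nullMeasurableSet_indexTuple hσ.toIsNonsingularAction hκ.nullMeasurableSet a)⟩,
      fun l a => Subtype.ext (glue_indexTuple_smul hσ hκ f l a)⟩⟩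
  map_add' f f' := by
    refine Subtype.ext (funext fun a => Subtype.ext (LInfty.ext_rep ?_))
    have h : ∀ f : Cochain (onInvariants ρ σ hc) n, _ := fun f =>
      rep_glue_indexTuple hσ.toIsNonsingularAction hκ f a
    filter_upwards [h f, h f', h (f + f'),
      LInfty.rep_add (glue (fun b => (f.1 b).1) fun ω i => κ (t' (a i)⁻¹ ω))
        (glue (fun b => (f'.1 b).1) fun ω i => κ (t' (a i)⁻¹ ω)),
      ae_all_iff.2 fun b => LInfty.rep_add (f.1 b).1 (f'.1 b).1] with ω h1 h2 h3 h4 h5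
    exact h3.trans ((h5 _).trans (h4.trans (congrArg₂ (· + ·) h1 h2)).symm)
  map_smul' c f := by
    refine Subtype.ext (funext fun a => Subtype.ext (LInfty.ext_rep ?_))
    have h : ∀ f : Cochain (onInvariants ρ σ hc) n, _ := fun f =>
      rep_glue_indexTuple hσ.toIsNonsingularAction hκ f a
    filter_upwards [h f, h (c • f),
      LInfty.rep_smul c (glue (fun b => (f.1 b).1) fun ω i => κ (t' (a i)⁻¹ ω)),
      ae_all_iff.2 fun b => LInfty.rep_smul c (f.1 b).1] with ω h1 h2 h3 h4
    exact h2.trans ((h4 _).trans (h3.trans (congrArg (c • ·) h1)).symm)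

section

variable {hc : ∀ k l, Commute (ρ k) (σ l)} (hρ : IsInducedRep ρ A t) (hσ : IsInducedRep σ A' t')
  (htt' : ∀ k l ω, t k (t' l ω) = t' l (t k ω)) (hκ : IsIndexMap M t κ)

theorem rep_pullback {n : ℕ} (f : Cochain (onInvariants ρ σ hc) n) (a : Fin (n + 1) → L) :
    ((pullback hρ hσ htt' hκ n f).1 a).1.rep =ᵐ[M]
      fun ω => (f.1 fun i => κ (t' (a i)⁻¹ ω)).1.rep ω :=
  rep_glue_indexTuple hσ.toIsNonsingularAction hκ f a

/-- The `i`-th index depends on the `i`-th argument alone, so omitting an argument commutes with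
substituting indices. -/
theorem pullback_coboundary (n : ℕ) (f : Cochain (onInvariants ρ σ hc) n) :
    pullback hρ hσ htt' hκ (n + 1) (coboundary _ n f) =
      coboundary _ n (pullback hρ hσ htt' hκ n f) := by
  refine Subtype.ext (funext fun a => Subtype.ext (LInfty.ext_rep ?_))
  filter_upwards [rep_pullback hρ hσ htt' hκ (coboundary _ n f) a,
    ae_all_iff.2 fun b => rep_coboundary f b,
    rep_coboundary (pullback hρ hσ htt' hκ n f) a,
    ae_all_iff.2 fun j : Fin (n + 2) =>
      rep_pullback hρ hσ htt' hκ f fun i => a (j.succAbove i)] with ω h1 h2 h3 h4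
  rw [h1, h2, h3]
  exact Finset.sum_congr rfl fun j _ => by rw [h4 j]

/-- If `κ` sends `κ'(k⁻¹ ω)⁻¹ ω` to `k`, the pullback along `κ'` is a left inverse of the pullback
along `κ`. -/
theorem pullback_pullback [Countable L] {κ' : Ω → L} (hκ' : IsIndexMap M t' κ')
    (h : ∀ k, ∀ᵐ ω ∂M, κ (t' (κ' (t k⁻¹ ω))⁻¹ ω) = k) (n : ℕ)
    (f : Cochain (onInvariants ρ σ hc) n) :
    pullback hσ hρ (fun l k ω => (htt' k l ω).symm) hκ' n (pullback hρ hσ htt' hκ n f) = f := by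
  refine Subtype.ext (funext fun a => Subtype.ext (LInfty.ext_rep ?_))
  filter_upwards [rep_pullback hσ hρ (fun l k ω => (htt' k l ω).symm) hκ'
      (pullback hρ hσ htt' hκ n f) a,
    ae_all_iff.2 fun b => rep_pullback hρ hσ htt' hκ f b,
    ae_all_iff.2 fun i => h (a i)] with ω h1 h2 h3
  rw [h1, h2]
  simp only [h3]

end

end Pullback

/-! ### The orbit equivalence relation -/

section OrbitRelation

variable {Γ G X : Type*} [Group Γ] [Group G] [MulAction Γ X] [MulAction G X]

/-- For an enumeration `e` of `G`, the pairs `(s, g s)` for which `g` comes first among the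
elements of `G` that carry `s` to a point of `Γ g s`. -/
def firstReturnDomain (Γ : Type*) {G X : Type*} [Group Γ] [Group G] [MulAction Γ X]
    [MulAction G X] (e : G → ℕ) : Set (X × X) :=
  {ω | ∃ g : G, g • ω.1 = ω.2 ∧ ∀ (γ : Γ) (g' : G), g' • ω.1 = γ • ω.2 → e g ≤ e g'}

theorem existsUnique_actRight_mem_firstReturnDomain {e : G → ℕ} (he : Function.Injective e)
    {ω : X × X} (hω : ω ∈ (orbitRelation G : Set (X × X)))
    (hfree : Function.Injective fun γ : Γ => γ • ω.2) :
    ∃! γ : Γ, actRight γ ω ∈ firstReturnDomain Γ e := by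
  classical
  let S : Set ℕ := {m | ∃ (g : G) (γ : Γ), g • ω.1 = γ • ω.2 ∧ e g = m}
  have hS : S.Nonempty := by
    obtain ⟨g, hg⟩ := hω
    refine ⟨_, g⁻¹, 1, ?_, rfl⟩
    rw [← hg]
    simp
  obtain ⟨g, γ, hg, hm⟩ := Nat.sInf_mem hS
  refine ⟨γ, ⟨g, hg, fun γ' g' h' => ?_⟩, ?_⟩
  · rw [hm]
    refine Nat.sInf_le ⟨g', γ' * γ, ?_, rfl⟩
    rw [mul_smul]
    exact h'
  · rintro γ' ⟨g', hg', hmin⟩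
    have hg'' : g' • ω.1 = γ' • ω.2 := hg'
    have h1 : e g' ≤ e g := hmin (γ * γ'⁻¹) g (by simp [actRight, mul_smul, hg])
    have h2 : e g ≤ e g' := by
      rw [hm]
      exact Nat.sInf_le ⟨g', γ', hg'', rfl⟩
    have h3 : g' = g := he (le_antisymm h1 h2)
    refine hfree ?_
    change γ' • ω.2 = γ • ω.2
    rw [← hg, ← hg'', h3]

/-- Giving `1` the least rank puts the diagonal into the first-return domain. -/
theorem exists_injective_nat_one_eq_zero (G : Type*) [Group G] [Countable G] :
    ∃ e : G → ℕ, Function.Injective e ∧ e 1 = 0 := by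
  classical
  obtain ⟨e, he⟩ := exists_injective_nat G
  exact ⟨fun g => Equiv.swap (e 1) 0 (e g), (Equiv.injective _).comp he, Equiv.swap_apply_left _ _⟩

variable [MeasurableSpace X] [Countable G] [MeasurableConstSMul G X] {μ : Measure X}

/-- The map `x ↦ (g x, x)` is an injective Borel map of standard Borel spaces, hence a measurable
embedding; this is why `p` need not be measurable, which matters for predicates such as `∃!`. -/
theorem ae_orbitMeasure_iff [StandardBorelSpace X] {p : X × X → Prop} :
    (∀ᵐ ω ∂orbitMeasure G μ, p ω) ↔ ∀ᵐ x ∂μ, ∀ g : G, p (g • x, x) := by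
  rw [orbitMeasure, Measure.ae_sum_iff, ae_all_iff]
  refine forall_congr' fun g => ?_
  have he : MeasurableEmbedding fun x : X => (g • x, x) :=
    Measurable.measurableEmbedding (by fun_prop) fun x y hxy => congrArg Prod.snd hxy
  exact he.ae_map_iff

theorem isNonsingularAction_actLeft :
    IsNonsingularAction (orbitMeasure G μ) (actLeft : G → X × X → X × X) where
  one ω := by simp [actLeft]
  mul g g' ω := by simp [actLeft, mul_smul]
  quasi g := (measurePreserving_actLeft g).quasiMeasurePreserving

/-- Almost every point has the form `(g x, x)`; `g⁻¹` brings it to the diagonal, and freeness allows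
no other element. -/
theorem existsUnique_actLeft_mem_diagonal [StandardBorelSpace X]
    (h : ∀ᵐ x ∂μ, Function.Injective fun g : G => g • x) :
    ∀ᵐ ω ∂orbitMeasure G μ, ∃! g : G, actLeft g ω ∈ Set.diagonal X := by
  rw [ae_orbitMeasure_iff]
  filter_upwards [h] with x hx g
  refine ⟨g⁻¹, by simp [actLeft], fun k hk => ?_⟩
  have h1 : (k * g) • x = (1 : G) • x := by
    rw [mul_smul, one_smul]
    exact hk
  exact eq_inv_of_mul_eq_one_left (hx h1)

variable {B : Type*} [NormedAddCommGroup B] [NormedSpace ℂ B]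

theorem isInducedRep_repG {Γ : Type*} [Group Γ] (D : DualBimodule G Γ B) :
    IsInducedRep (repG μ D) (fun g => D.actG g) actLeft where
  toIsNonsingularAction := isNonsingularAction_actLeft
  rep_apply _ F := rep_transform _ _ _ _ F

variable [MeasurableConstSMul Γ X]

theorem isNonsingularAction_actRight [SMulInvariantMeasure Γ X μ]
    (h : IsOrbitalEmbedding Γ G μ) :
    IsNonsingularAction (orbitMeasure G μ) (actRight : Γ → X × X → X × X) where
  one ω := by simp [actRight]
  mul g g' ω := by simp [actRight, mul_smul]
  quasi γ := (measurePreserving_actRight h γ).quasiMeasurePreserving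

theorem measurableSet_firstReturnDomain [Countable Γ] [StandardBorelSpace X] (e : G → ℕ) :
    MeasurableSet (firstReturnDomain Γ e : Set (X × X)) := by
  let := upgradeStandardBorel X
  refine measurableSet_setOfPred.2 (Measurable.exists fun g => Measurable.and ?_ ?_)
  · exact measurableSet_setOfPred.1 (measurableSet_eq_fun (by fun_prop) (by fun_prop))
  · refine Measurable.forall fun γ => Measurable.forall fun g' => Measurable.imp ?_ ?_
    · exact measurableSet_setOfPred.1 (measurableSet_eq_fun (by fun_prop) (by fun_prop))
    · exact measurable_const

theorem exists_isInductionDomain [Countable Γ] [StandardBorelSpace X]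
    (h : IsOrbitalEmbedding Γ G μ) : ∃ Y : Set (X × X), IsInductionDomain Γ G μ Y := by
  obtain ⟨e, he, he1⟩ := exists_injective_nat_one_eq_zero G
  refine ⟨firstReturnDomain Γ e, measurableSet_firstReturnDomain e, ?_, ?_⟩
  · rw [ae_orbitMeasure_iff]
    filter_upwards [h.freeΓ] with x hx g
    exact existsUnique_actRight_mem_firstReturnDomain he ⟨g, rfl⟩ hx
  · exact Eventually.of_forall fun x => ⟨1, one_smul G x, fun _ _ _ => he1.le.trans (Nat.zero_le _)⟩

/-! ### Composing the two index maps, and the induced map on cohomology -/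

variable [SMulInvariantMeasure Γ X μ]

/-- The geometric core of injectivity, and the one place where `Y` must contain the diagonal. -/
theorem domainIndex_actRight_actLeft [Countable Γ] [StandardBorelSpace X]
    (h : IsOrbitalEmbedding Γ G μ) {Y : Set (X × X)} (hY : IsInductionDomain Γ G μ Y) (γ : Γ) :
    ∀ᵐ ω ∂orbitMeasure G μ,
      domainIndex actRight Y
        (actLeft (domainIndex actLeft (Set.diagonal X) (actRight γ⁻¹ ω) : G)⁻¹ ω) = γ := by
  have h1 : ∀ᵐ ω ∂orbitMeasure G μ, ∃! g : G, actLeft g (actRight γ⁻¹ ω) ∈ Set.diagonal X :=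
    ((isNonsingularAction_actRight h).quasi γ⁻¹).ae
      (p := fun ω => ∃! g : G, actLeft g ω ∈ Set.diagonal X)
      (existsUnique_actLeft_mem_diagonal h.freeG)
  -- All `g` are treated at once because the index in `G` used below varies with `ω`.
  have h2 : ∀ᵐ ω ∂orbitMeasure G μ, ∀ g : G, ∃! γ : Γ, actRight γ (actLeft g ω) ∈ Y :=
    ae_all_iff.2 fun g => (isNonsingularAction_actLeft.quasi g).ae
      (p := fun ω => ∃! γ : Γ, actRight γ ω ∈ Y) hY.existsUnique
  have h3 : ∀ᵐ ω ∂orbitMeasure G μ, (γ⁻¹ • ω.2, γ⁻¹ • ω.2) ∈ Y := by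
    rw [ae_orbitMeasure_iff]
    filter_upwards [(measurePreserving_smul γ⁻¹ μ).quasiMeasurePreserving.ae hY.diagonal]
      with x hx _ using hx
  filter_upwards [h1, h2, h3] with ω h1 h2 h3
  generalize hg : (domainIndex actLeft (Set.diagonal X) (actRight γ⁻¹ ω) : G) = g
  rw [domainIndex_eq_iff (h2 _)]
  rw [domainIndex_eq_iff h1, Set.mem_diagonal_iff] at hg
  -- With `ω = (s, x)`, `hg` now says `g⁻¹ s = γ⁻¹ x`, so the point to be placed in `Y` is the
  -- diagonal point `(γ⁻¹ x, γ⁻¹ x)` of `h3`.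
  simp only [actRight, actLeft] at hg ⊢
  rwa [hg]

theorem isInducedRep_repΓ (h : IsOrbitalEmbedding Γ G μ) (D : DualBimodule G Γ B) :
    IsInducedRep (repΓ h D) (fun γ => D.actΓ γ) actRight where
  toIsNonsingularAction := isNonsingularAction_actRight h
  rep_apply _ F := rep_transform _ _ _ _ F

theorem exists_injective_hb_isPullback [Countable Γ] [StandardBorelSpace X]
    (h : IsOrbitalEmbedding Γ G μ) {Y : Set (X × X)} (hY : IsInductionDomain Γ G μ Y)
    (D : DualBimodule G Γ B) (n : ℕ) :
    ∃ Φ : Hb (invG h D) n →ₗ[ℂ] Hb (invΓ h D) n, Function.Injective Φ ∧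
      ∀ f : Cocycle (invG h D) n, ∃ f' : Cocycle (invΓ h D) n,
        IsPullback h D Y f f' ∧ Φ (Hb.mk (invG h D) n f) = Hb.mk (invΓ h D) n f' := by
  have hG := isInducedRep_repG (μ := μ) D
  have hΓ := isInducedRep_repΓ h D
  have hcomm : ∀ (γ : Γ) (g : G) (ω : X × X),
      actRight γ (actLeft g ω) = actLeft g (actRight γ ω) := fun _ _ _ => rfl
  have hκ : IsIndexMap (orbitMeasure G μ) actRight (domainIndex (K := Γ) actRight Y) :=
    isIndexMap_domainIndex hΓ.toIsNonsingularAction hY.measurableSet hY.existsUnique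
  have hκ' : IsIndexMap (orbitMeasure G μ) actLeft (domainIndex (K := G) actLeft (Set.diagonal X)) :=
    isIndexMap_domainIndex hG.toIsNonsingularAction measurableSet_diagonal
      (existsUnique_actLeft_mem_diagonal h.freeG)
  let φ := pullback (hc := fun γ g => (commute_repG_repΓ h D g γ).symm) hΓ hG hcomm hκ
  let ψ := pullback (hc := commute_repG_repΓ h D) hG hΓ (fun _ _ _ => rfl) hκ'
  have hφ : ∀ n f, φ (n + 1) (coboundary (invG h D) n f) = coboundary (invΓ h D) n (φ n f) :=
    pullback_coboundary hΓ hG hcomm hκ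
  have hψ : ∀ n f, ψ (n + 1) (coboundary (invΓ h D) n f) = coboundary (invG h D) n (ψ n f) :=
    pullback_coboundary hG hΓ (fun _ _ _ => rfl) hκ'
  refine ⟨hbMap φ hφ n, hbMap_injective φ hφ ψ hψ
    (pullback_pullback hΓ hG hcomm hκ hκ' (domainIndex_actRight_actLeft h hY)) n, fun f =>
    ⟨cocycleMap (φ n) (φ (n + 1)) (hφ n) f, fun g => ?_, hbMap_mk φ hφ n f⟩⟩
  -- `chi Γ Y ω g` unfolds to `domainIndex actRight Y (actLeft g ω)`, so the two formulas agree by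
  -- definition.
  exact rep_pullback hΓ hG hcomm hκ f.1 g

end OrbitRelation

end MonodShalom

end

theorem mainTheorem4 {Γ G X : Type*} [Group Γ] [Countable Γ] [Group G] [Countable G]
    [MeasurableSpace X] [StandardBorelSpace X] [MulAction Γ X] [MulAction G X]
    [MeasurableConstSMul Γ X] [MeasurableConstSMul G X]
    (μ : MeasureTheory.Measure X) [MeasureTheory.IsProbabilityMeasure μ]
    [MeasureTheory.SMulInvariantMeasure Γ X μ] [MeasureTheory.SMulInvariantMeasure G X μ]
    (h : MonodShalom.IsOrbitalEmbedding Γ G μ) :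
    (∃ Y : Set (X × X), MonodShalom.IsInductionDomain Γ G μ Y) ∧
    ∀ Y : Set (X × X), MonodShalom.IsInductionDomain Γ G μ Y → ∀ n : ℕ, 1 ≤ n →
      (∃ Φ : MonodShalom.Hb (MonodShalom.invG h (MonodShalom.operatorBimodule h)) n →ₗ[ℂ]
            MonodShalom.Hb (MonodShalom.invΓ h (MonodShalom.operatorBimodule h)) n,
          Function.Injective Φ ∧
          ∀ f : MonodShalom.Cocycle (MonodShalom.invG h (MonodShalom.operatorBimodule h)) n,
            ∃ f' : MonodShalom.Cocycle (MonodShalom.invΓ h (MonodShalom.operatorBimodule h)) n,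
              MonodShalom.IsPullback h (MonodShalom.operatorBimodule h) Y f f' ∧
              Φ (MonodShalom.Hb.mk (MonodShalom.invG h (MonodShalom.operatorBimodule h)) n f) =
                MonodShalom.Hb.mk (MonodShalom.invΓ h (MonodShalom.operatorBimodule h)) n f') ∧
      ∀ (B : Type*) [NormedAddCommGroup B] [NormedSpace ℂ B] (D : MonodShalom.DualBimodule G Γ B),
        ∃ Φ : MonodShalom.Hb (MonodShalom.invG h D) n →ₗ[ℂ] MonodShalom.Hb (MonodShalom.invΓ h D) n,
          Function.Injective Φ ∧
          ∀ f : MonodShalom.Cocycle (MonodShalom.invG h D) n,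
            ∃ f' : MonodShalom.Cocycle (MonodShalom.invΓ h D) n,
              MonodShalom.IsPullback h D Y f f' ∧
              Φ (MonodShalom.Hb.mk (MonodShalom.invG h D) n f) =
                MonodShalom.Hb.mk (MonodShalom.invΓ h D) n f' := by
  refine ⟨MonodShalom.exists_isInductionDomain h, fun Y hY n _ => ⟨?_, fun B _ _ D => ?_⟩⟩
  · exact MonodShalom.exists_injective_hb_isPullback h hY (MonodShalom.operatorBimodule h) n
  · exact MonodShalom.exists_injective_hb_isPullback h hY D n
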